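/- Let $X$ be a compact complex manifold of pure dimension $n$ with canonical bundle $K_X$, and let $A$ be a holomorphic line bundle on $X$ (for instance, $X$ a smooth projective variety with pseudoeffective $K_X$ and $A$ sufficiently ample). For a $C^\infty$ hermitian metric $h_A$ on $A$ and an integer $m\ge 1$ put $$\hat K_m^A(x):=\sup\Big\{|\sigma|^{2/m}(x)\ :\ \sigma\in\Gamma(X,\mathcal O_X(A+mK_X)),\ \Big|\int_X h_A^{1/m}\cdot(\sigma\wedge\bar\sigma)^{1/m}\Big|=1\Big\}\qquad(x\in X),$$ the supremum being taken in the fibre at $x$ of the real line bundle $|A|^{2/m}\otimes|K_X|^2$ (it is $0$ if there is no such $\sigma$). Here, if locally $\sigma=f\,e_A\otimes(dz_1\wedge\dots\wedge dz_n)^{\otimes m}$ with a local holomorphic frame $e_A$ of $A$ and local coordinates $z$, then $|\sigma|^{2/m}$ has the coefficient $|f|^{2/m}$, and $|h_A^{1/m}(\sigma\wedge\bar\sigma)^{1/m}|$ is the semipositive $(n,n)$-form $h_A(e_A,e_A)^{1/m}|f|^{2/m}\,|dz\wedge d\bar z|$ with $dz=dz_1\wedge\dots\wedge dz_n$. Thus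 $h_A^{1/m}\cdot\hat K_m^A$ is a semipositive $(n,n)$-form (a section of $|K_X|^2$). Put $$\hat K_\infty^A:=\limsup_{m\to\infty}h_A^{1/m}\cdot\hat K_m^A\quad\text{(pointwise)},\qquad \hat h_{can,A}:=\text{the lower semicontinuous envelope of }(\hat K_\infty^A)^{-1},$$ the latter a singular hermitian metric on $K_X$, with values in $[0,\infty]$ and $0^{-1}=\infty$. Then $\hat K_\infty^A$ does not depend on the choice of the $C^\infty$ hermitian metric $h_A$ on $A$: any two such metrics give the same $\hat K_\infty^A$ at every point of $X$. Hence $\hat h_{can,A}$ does not depend on the choice of $h_A$ either. -/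

import Mathlib

open Bundle Filter Topology MeasureTheory
open scoped Manifold ContDiff ENNReal TensorProduct

noncomputable section

namespace Supercanonical

/-- The model space `ℂⁿ` of complex `n`-folds. -/
abbrev Model (n : ℕ) : Type := Fin n → ℂ

section Canonical

variable {n : ℕ} {X : Type*} [TopologicalSpace X] [ChartedSpace (Model n) X]

/-- The holomorphic tangent space `T_x X` of the complex manifold `X`. -/
abbrev Tan (n : ℕ) {X : Type*} [TopologicalSpace X] [ChartedSpace (Model n) X] (x : X) : Type :=
  TangentSpace 𝓘(ℂ, Model n) x

/-- The fibre at `x` of the canonical bundle `K_X = ⋀ⁿ T^*X`. -/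
abbrev CanFiber (n : ℕ) {X : Type*} [TopologicalSpace X] [ChartedSpace (Model n) X] (x : X) :
    Type :=
  (Tan n x) [⋀^Fin n]→ₗ[ℂ] ℂ

/-- The coordinate frame `(∂/∂z₁, …, ∂/∂zₙ)` at `x` of a holomorphic chart `φ = (z₁, …, zₙ)`. -/
def coordFrame (φ : OpenPartialHomeomorph X (Model n)) (x : X) : Fin n → Tan n x := fun i =>
  ContinuousLinearMap.inverse (mfderiv 𝓘(ℂ, Model n) 𝓘(ℂ, Model n) φ x) (Pi.single i (1 : ℂ))

/-- Evaluation of an `n`-form at `x` on an `n`-tuple of tangent vectors. -/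
def evalForm {x : X} (v : Fin n → Tan n x) : CanFiber n x →ₗ[ℂ] ℂ where
  toFun ξ := ξ v
  map_add' _ _ := rfl
  map_smul' _ _ := rfl

/-- Evaluation of an element of `K_{X,x}^{⊗ m}` on an `n`-tuple of tangent vectors:
`ξ₁ ⊗ ⋯ ⊗ ξ_m ↦ ξ₁(v) ⋯ ξ_m(v)`. -/
def evalPow (m : ℕ) {x : X} (v : Fin n → Tan n x) : (⨂[ℂ]^m (CanFiber n x)) →ₗ[ℂ] ℂ :=
  PiTensorProduct.lift
    ((MultilinearMap.mkPiAlgebra ℂ (Fin m) ℂ).compLinearMap fun _ => evalForm v)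

/-- A (pointwise, not necessarily continuous) semipositive `(n,n)`-form on `X` with values in
`[0, ∞]`, i.e. a section of `|K_X|²`, given through its values on `n`-tuples of tangent vectors:
`g · |ξ|²` with `ξ ∈ K_{X,x}` is the function `v ↦ g · |ξ(v)|²`. -/
abbrev Density (n : ℕ) (X : Type*) [TopologicalSpace X] [ChartedSpace (Model n) X] : Type _ :=
  ∀ x : X, (Fin n → Tan n x) → ℝ≥0∞

/-- The coefficient `g` of a semipositive `(n,n)`-form `g · |dz₁ ∧ ⋯ ∧ dzₙ|²` in the
chart `φ = (z₁, …, zₙ)`. -/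
def Density.coeff (η : Density n X) (φ : OpenPartialHomeomorph X (Model n)) (x : X) : ℝ≥0∞ :=
  η x (coordFrame φ x)

/-- The integral over `X` of a semipositive `(n,n)`-form.  It is the supremum, over all finite
families of pairwise disjoint measurable pieces that lie in chart domains, of the sums of the
integrals over the pieces; in a chart, `|dz ∧ dz̄|` (with `dz = dz₁ ∧ ⋯ ∧ dzₙ`) is `2ⁿ` times
Lebesgue measure.  (On a compact `X` the supremum is attained by every decomposition of `X` into
such pieces.) -/
def Density.integral (η : Density n X) : ℝ≥0∞ :=
  ⨆ (N : ℕ) (φ : Fin N → OpenPartialHomeomorph X (Model n)) (S : Fin N → Set X)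
    (_ : ∀ i, φ i ∈ atlas (Model n) X ∧ S i ⊆ (φ i).source ∧ MeasurableSet (φ i '' S i))
    (_ : Pairwise fun i j => Disjoint (S i) (S j)),
    ∑ i, ∫⁻ z in φ i '' S i, 2 ^ n * η.coeff (φ i) ((φ i).symm z)

end Canonical

section LineBundle

variable {n : ℕ} {X : Type*} [TopologicalSpace X] [ChartedSpace (Model n) X]
  (A : X → Type*) [TopologicalSpace (TotalSpace ℂ A)] [∀ x, AddCommGroup (A x)]
  [∀ x, Module ℂ (A x)] [∀ x, TopologicalSpace (A x)] [FiberBundle ℂ A]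

/-- A `C^∞` hermitian metric on the holomorphic line bundle `A`: a positive definite hermitian
form on every fibre such that `h(e, e)` is (real) `C^∞` for the frame `e` of each local
trivialization of `A`. -/
structure SmoothHermitianMetric (n : ℕ) {X : Type*} [TopologicalSpace X]
    [ChartedSpace (Model n) X] (A : X → Type*) [TopologicalSpace (TotalSpace ℂ A)]
    [∀ x, AddCommGroup (A x)] [∀ x, Module ℂ (A x)] [∀ x, TopologicalSpace (A x)]
    [FiberBundle ℂ A] where
  form : ∀ x, A x →ₗ⋆[ℂ] A x →ₗ[ℂ] ℂ
  conj_symm : ∀ x (v w : A x), starRingEnd ℂ (form x v w) = form x w v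
  pos : ∀ x (v : A x), v ≠ 0 → 0 < (form x v v).re
  smooth : ∀ (e : Trivialization ℂ (TotalSpace.proj : TotalSpace ℂ A → X))
    [MemTrivializationAtlas e],
    ContMDiffOn 𝓘(ℝ, Model n) 𝓘(ℝ, ℝ) ∞
      (fun x => (form x (e.symm x 1) (e.symm x 1)).re) e.baseSet

/-- `h(a, a)` as an element of `[0, ∞]`. -/
def SmoothHermitianMetric.sq {A} [TopologicalSpace (TotalSpace ℂ A)] [∀ x, AddCommGroup (A x)]
    [∀ x, Module ℂ (A x)] [∀ x, TopologicalSpace (A x)] [FiberBundle ℂ A]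
    (h : SmoothHermitianMetric n A) {x : X} (a : A x) : ℝ≥0∞ :=
  ENNReal.ofReal (h.form x a a).re

/-- The fibre at `x` of the line bundle `A + m K_X`, that is `A ⊗ K_X^{⊗ m}`. -/
abbrev AdjFiber (n : ℕ) {X : Type*} [TopologicalSpace X] [ChartedSpace (Model n) X]
    (A : X → Type*) [∀ x, AddCommGroup (A x)] [∀ x, Module ℂ (A x)] (m : ℕ) (x : X) : Type _ :=
  A x ⊗[ℂ] (⨂[ℂ]^m (CanFiber n x))

variable {A}

/-- Evaluation of an element of `A_x ⊗ K_{X,x}^{⊗ m}` on an `n`-tuple of tangent vectors: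
`a ⊗ ξ₁ ⊗ ⋯ ⊗ ξ_m ↦ ξ₁(v) ⋯ ξ_m(v) · a`. -/
def evalAdj (m : ℕ) {x : X} (v : Fin n → Tan n x) : AdjFiber n A m x →ₗ[ℂ] A x :=
  (TensorProduct.rid ℂ (A x)).toLinearMap ∘ₗ LinearMap.lTensor (A x) (evalPow m v)

/-- `σ ∈ Γ(X, O_X(A + m K_X))`: in every holomorphic chart `(z₁, …, zₙ)` one has
`σ = f ⊗ (dz₁ ∧ ⋯ ∧ dzₙ)^{⊗ m}` with a holomorphic local section `f` of `A`; the section `f` is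
the value of `σ` on the coordinate frame. -/
def IsHolomorphicSection (m : ℕ) (σ : ∀ x, AdjFiber n A m x) : Prop :=
  ∀ φ ∈ atlas (Model n) X,
    ContMDiffOn 𝓘(ℂ, Model n) (𝓘(ℂ, Model n).prod 𝓘(ℂ, ℂ)) ω
      (fun x => TotalSpace.mk' ℂ x (evalAdj m (coordFrame φ x) (σ x))) φ.source

/-- The semipositive `(n,n)`-form `|h_A^{1/m} · (σ ∧ σ̄)^{1/m}|`. -/
def sectionDensity (h : SmoothHermitianMetric n A) (m : ℕ) (σ : ∀ x, AdjFiber n A m x) :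
    Density n X := fun _ v =>
  h.sq (evalAdj m v (σ _)) ^ (1 / (m : ℝ))

/-- The extremal function `K̂_m^A`, a section of `|A|^{2/m} ⊗ |K_X|²`: the supremum of
`|σ|^{2/m}` over the global holomorphic sections `σ` of `A + m K_X` with
`|∫_X h_A^{1/m} · (σ ∧ σ̄)^{1/m}| = 1`.  It is given by its coefficients in `[0, ∞]` relative to
the frames `e` of local trivializations of `A`, on `n`-tuples of tangent vectors. -/
def Khat (h : SmoothHermitianMetric n A) (m : ℕ)
    (e : Trivialization ℂ (TotalSpace.proj : TotalSpace ℂ A → X)) (x : X)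
    (v : Fin n → Tan n x) : ℝ≥0∞ :=
  ⨆ (σ : ∀ x, AdjFiber n A m x) (_ : IsHolomorphicSection m σ)
    (_ : (sectionDensity h m σ).integral = 1),
    ‖(e ⟨x, evalAdj m v (σ x)⟩).2‖ₑ ^ (2 / (m : ℝ))

/-- The semipositive `(n,n)`-form `h_A^{1/m} · K̂_m^A`: at `x` it is `h_A(e, e)^{1/m}` times the
coefficient of `K̂_m^A` relative to `e`, for a local frame `e` of `A` around `x`. -/
def metricKhat (h : SmoothHermitianMetric n A) (m : ℕ) : Density n X := fun x v =>
  h.sq ((trivializationAt ℂ A x).symm x 1) ^ (1 / (m : ℝ)) *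
    Khat h m (trivializationAt ℂ A x) x v

/-- `K̂_∞^A = limsup_{m → ∞} h_A^{1/m} · K̂_m^A`. -/
def KhatInfty (h : SmoothHermitianMetric n A) : Density n X := fun x v =>
  limsup (fun m : ℕ => metricKhat h m x v) atTop

/-- The lower (semicontinuous) envelope of `(K̂_∞^A)⁻¹` in the chart `φ`: the weight
`ĥ_{can,A}(dz₁ ∧ ⋯ ∧ dzₙ, dz₁ ∧ ⋯ ∧ dzₙ)`.  The filter `𝓝 x` includes the point `x`, so the
`liminf` is the largest lower semicontinuous minorant. -/
def hcanWeight (h : SmoothHermitianMetric n A) (φ : OpenPartialHomeomorph X (Model n)) (x : X) :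
    ℝ≥0∞ :=
  liminf (fun y => ((KhatInfty h).coeff φ y)⁻¹) (𝓝 x)

/-- The singular hermitian metric `ĥ_{can,A}` on `K_X`, as the function
`ξ ↦ ĥ_{can,A}(ξ, ξ) ∈ [0, ∞]` on the fibres of `K_X`. -/
def hcan (h : SmoothHermitianMetric n A) (x : X) (ξ : CanFiber n x) : ℝ≥0∞ :=
  ‖ξ (coordFrame (chartAt (Model n) x) x)‖ₑ ^ 2 * hcanWeight h (chartAt (Model n) x) x

end LineBundle

end Supercanonical

end

/-!
Any two hermitian metrics on a line bundle over a compact base satisfy `h ≤ C h'` and `h' ≤ D h`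
for some constants `C` and `D`. In `h^{1/m} · K̂_m`, which is the supremum of the forms
`|h^{1/m} (σ ∧ σ̄)^{1/m}|` over the sections `σ` of integral `1`, a change of metric therefore
costs at most `C^{1/m}` in the form and `D^{1/m}` in its normalization. Both factors tend to `1`,
so the upper limits over `m` agree.
-/

open scoped NNReal

namespace Supercanonical

theorem exists_forall_of_forall_exists_eventually {X ι : Type*} [TopologicalSpace X]
    [CompactSpace X] [Preorder ι] [IsDirectedOrder ι] [Nonempty ι] {p : X → ι → Prop}
    (hmono : ∀ x, Monotone (p x)) (hloc : ∀ x, ∃ i, ∀ᶠ y in 𝓝 x, p y i) :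
    ∃ i, ∀ x, p x i := by
  classical
  choose i hi using hloc
  obtain ⟨t, -, ht⟩ := isCompact_univ.elim_nhds_subcover (fun x => {y | p y (i x)}) fun x _ => hi x
  obtain ⟨j, hj⟩ := (t.image i).exists_le
  refine ⟨j, fun y => ?_⟩
  obtain ⟨x, hx, hy⟩ := Set.mem_iUnion₂.1 (ht (Set.mem_univ y))
  exact hmono y (hj _ (Finset.mem_image_of_mem i hx)) hy

theorem exists_enorm_rpow_eq {p : ℝ} (hp : p ≠ 0) {r : ℝ≥0∞} (h0 : r ≠ 0) (hr : r ≠ ⊤) :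
    ∃ c : ℂ, ‖c‖ₑ ^ p = r := by
  lift r to ℝ≥0 using hr
  refine ⟨((r ^ p⁻¹ : ℝ≥0) : ℝ), ?_⟩
  have henorm : ‖(((r ^ p⁻¹ : ℝ≥0) : ℝ) : ℂ)‖ₑ = (r : ℝ≥0∞) ^ p⁻¹ := by
    rw [enorm_eq_nnnorm, Complex.nnnorm_real, NNReal.nnnorm_eq,
      ENNReal.coe_rpow_of_ne_zero (ENNReal.coe_ne_zero.1 h0)]
  rw [henorm, ENNReal.rpow_inv_rpow hp]

theorem tendsto_rpow_one_div_atTop {C : ℝ≥0} (hC : C ≠ 0) :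
    Tendsto (fun m : ℕ => (C : ℝ≥0∞) ^ (1 / (m : ℝ))) atTop (𝓝 1) := by
  have hlim : Tendsto (fun m : ℕ => C ^ (1 / (m : ℝ))) atTop (𝓝 (C ^ (0 : ℝ))) :=
    tendsto_const_nhds.nnrpow tendsto_one_div_atTop_nhds_zero_nat (Or.inl hC)
  rw [NNReal.rpow_zero] at hlim
  simpa only [ENNReal.coe_rpow_of_ne_zero hC, ENNReal.coe_one] using
    ENNReal.tendsto_coe.2 hlim

theorem limsup_mul_le_of_tendsto_one {ι : Type*} {l : Filter ι} [l.NeBot] {a : ι → ℝ≥0∞}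
    (ha : Tendsto a l (𝓝 1)) (u : ι → ℝ≥0∞) :
    limsup (fun i => a i * u i) l ≤ limsup u l := by
  have hlim : limsup a l = 1 := ha.limsup_eq
  calc limsup (fun i => a i * u i) l ≤ limsup a l * limsup u l :=
        ENNReal.limsup_mul_le' (by simp [hlim]) (by simp [hlim])
    _ = limsup u l := by rw [hlim, one_mul]

theorem limsup_rpow_one_div_mul_le (C : ℝ≥0) (u : ℕ → ℝ≥0∞) :
    limsup (fun m : ℕ => (C : ℝ≥0∞) ^ (1 / (m : ℝ)) * u m) atTop ≤ limsup u atTop := by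
  have hpos : max C 1 ≠ 0 := (zero_lt_one.trans_le (le_max_right C 1)).ne'
  calc limsup (fun m : ℕ => (C : ℝ≥0∞) ^ (1 / (m : ℝ)) * u m) atTop
      ≤ limsup (fun m : ℕ => ((max C 1 : ℝ≥0) : ℝ≥0∞) ^ (1 / (m : ℝ)) * u m) atTop :=
        limsup_le_limsup <| .of_forall fun m => by
          dsimp only
          gcongr
          exact le_max_left C 1
    _ ≤ limsup u atTop := limsup_mul_le_of_tendsto_one (tendsto_rpow_one_div_atTop hpos) u

section Integral

variable {n : ℕ} {X : Type*} [TopologicalSpace X] [ChartedSpace (Model n) X]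

theorem Density.integral_mono {η η' : Density n X} (hη : ∀ x v, η x v ≤ η' x v) :
    η.integral ≤ η'.integral := by
  unfold Density.integral
  gcongr
  exact hη _ _

theorem Density.integral_const_mul {c : ℝ≥0∞} (hc : c ≠ ⊤) (η : Density n X) :
    Density.integral (fun x v => c * η x v) = c * η.integral := by
  simp only [Density.integral, Density.coeff, ENNReal.mul_iSup, Finset.mul_sum]
  simp only [← lintegral_const_mul' c _ hc, mul_left_comm c]

end Integral

variable {n : ℕ} {X : Type*} [TopologicalSpace X] [ChartedSpace (Model n) X]
  {A : X → Type*} [TopologicalSpace (TotalSpace ℂ A)] [∀ x, AddCommGroup (A x)]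
  [∀ x, Module ℂ (A x)] [∀ x, TopologicalSpace (A x)] [FiberBundle ℂ A]

namespace SmoothHermitianMetric

theorem sq_smul (h : SmoothHermitianMetric n A) {x : X} (c : ℂ) (a : A x) :
    h.sq (c • a) = ‖c‖ₑ ^ 2 * h.sq a := by
  have hform : h.form x (c • a) (c • a) = ((‖c‖ ^ 2 : ℝ) : ℂ) * h.form x a a := by
    simp only [map_smulₛₗ, LinearMap.smul_apply, smul_eq_mul, RingHom.id_apply]
    rw [← mul_assoc, Complex.mul_conj, Complex.normSq_eq_norm_sq]
  rw [sq, sq, hform, Complex.re_ofReal_mul, ENNReal.ofReal_mul (by positivity),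
    ENNReal.ofReal_pow (norm_nonneg c), ofReal_norm]

theorem sq_ne_zero (h : SmoothHermitianMetric n A) {x : X} {a : A x} (ha : a ≠ 0) :
    h.sq a ≠ 0 :=
  (ENNReal.ofReal_pos.2 (h.pos x a ha)).ne'

theorem continuousAt_sq_symm_one (h : SmoothHermitianMetric n A)
    (e : Trivialization ℂ (TotalSpace.proj : TotalSpace ℂ A → X)) [MemTrivializationAtlas e]
    {x : X} (hx : x ∈ e.baseSet) : ContinuousAt (fun y => h.sq (e.symm y 1)) x :=
  ENNReal.continuous_ofReal.continuousAt.comp <|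
    (h.smooth e).continuousOn.continuousAt (e.open_baseSet.mem_nhds hx)

/-- The relation `h ≤ C h'`, for some constant `C` on all of `X`, between hermitian metrics on the
same line bundle. -/
def IsBoundedBy (h h' : SmoothHermitianMetric n A) : Prop :=
  ∃ C : ℝ≥0, ∀ x (a : A x), h.sq a ≤ C * h'.sq a

section LineBundle

variable [VectorBundle ℂ ℂ A]

theorem sq_eq_enorm_sq_mul (h : SmoothHermitianMetric n A)
    (e : Trivialization ℂ (TotalSpace.proj : TotalSpace ℂ A → X)) [MemTrivializationAtlas e]
    {x : X} (hx : x ∈ e.baseSet) (a : A x) :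
    h.sq a = ‖(e ⟨x, a⟩).2‖ₑ ^ 2 * h.sq (e.symm x 1) := by
  have ha : a = (e ⟨x, a⟩).2 • e.symm x 1 := by
    rw [← e.symmₗ_apply (R := ℂ) hx, ← map_smul, smul_eq_mul, mul_one,
      e.symmₗ_apply (R := ℂ) hx, e.symm_apply_apply_mk hx]
  conv_lhs => rw [ha, h.sq_smul]

theorem exists_eventually_sq_le_mul_sq (h h' : SmoothHermitianMetric n A) (x : X) :
    ∃ C : ℝ≥0, ∀ᶠ y in 𝓝 x, ∀ a : A y, h.sq a ≤ C * h'.sq a := by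
  let e := trivializationAt ℂ A x
  have hx : x ∈ e.baseSet := FiberBundle.mem_baseSet_trivializationAt' x
  have hframe : e.symm x (1 : ℂ) ≠ 0 := by
    rw [← e.linearEquivAt_symm_apply (R := ℂ) x hx]
    exact (e.linearEquivAt ℂ x hx).symm.map_ne_zero_iff.2 one_ne_zero
  obtain ⟨C, hC⟩ : ∃ C : ℕ, h.sq (e.symm x 1) < C * h'.sq (e.symm x 1) :=
    ENNReal.exists_nat_mul_gt (h'.sq_ne_zero hframe) ENNReal.ofReal_ne_top
  have hlt : ∀ᶠ y in 𝓝 x, h.sq (e.symm y 1) < C * h'.sq (e.symm y 1) :=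
    (h.continuousAt_sq_symm_one e hx).eventually_lt
      (ENNReal.Tendsto.const_mul (h'.continuousAt_sq_symm_one e hx)
        (Or.inr (ENNReal.natCast_ne_top C))) hC
  refine ⟨C, ?_⟩
  filter_upwards [hlt, e.open_baseSet.mem_nhds hx] with y hy hye a
  rw [h.sq_eq_enorm_sq_mul e hye, h'.sq_eq_enorm_sq_mul e hye, mul_left_comm,
    ENNReal.coe_natCast]
  gcongr

theorem isBoundedBy [CompactSpace X] (h h' : SmoothHermitianMetric n A) : h.IsBoundedBy h' := by
  refine exists_forall_of_forall_exists_eventually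
    (p := fun x (C : ℝ≥0) => ∀ a : A x, h.sq a ≤ C * h'.sq a) (fun x C D hCD hC a => ?_)
    (exists_eventually_sq_le_mul_sq h h')
  exact (hC a).trans (by gcongr)

end LineBundle

end SmoothHermitianMetric

theorem sectionDensity_const_smul (h : SmoothHermitianMetric n A) (m : ℕ) (c : ℂ)
    (σ : ∀ x, AdjFiber n A m x) :
    sectionDensity h m (c • σ) = fun x v => ‖c‖ₑ ^ (2 / (m : ℝ)) * sectionDensity h m σ x v := by
  funext x v
  rw [sectionDensity, sectionDensity, Pi.smul_apply, map_smul, h.sq_smul,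
    ENNReal.mul_rpow_of_nonneg _ _ (by positivity), ← ENNReal.rpow_natCast_mul, Nat.cast_ofNat,
    mul_one_div]

theorem sectionDensity_le {h h' : SmoothHermitianMetric n A} {C : ℝ≥0∞}
    (hC : ∀ x (a : A x), h.sq a ≤ C * h'.sq a) (m : ℕ) (σ : ∀ x, AdjFiber n A m x) (x : X)
    (v : Fin n → Tan n x) :
    sectionDensity h m σ x v ≤ C ^ (1 / (m : ℝ)) * sectionDensity h' m σ x v := by
  rw [sectionDensity, sectionDensity, ← ENNReal.mul_rpow_of_nonneg _ _ (by positivity)]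
  gcongr
  exact hC _ _

theorem integral_sectionDensity_le {h h' : SmoothHermitianMetric n A} {C : ℝ≥0}
    (hC : ∀ x (a : A x), h.sq a ≤ C * h'.sq a) (m : ℕ) (σ : ∀ x, AdjFiber n A m x) :
    (sectionDensity h m σ).integral ≤ C ^ (1 / (m : ℝ)) * (sectionDensity h' m σ).integral := by
  have hfin : (C : ℝ≥0∞) ^ (1 / (m : ℝ)) ≠ ⊤ :=
    ENNReal.rpow_ne_top_of_nonneg (by positivity) ENNReal.coe_ne_top
  rw [← Density.integral_const_mul hfin]
  exact Density.integral_mono (sectionDensity_le hC m σ)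

section Extremal

variable [VectorBundle ℂ ℂ A]

theorem IsHolomorphicSection.const_smul {m : ℕ} {σ : ∀ x, AdjFiber n A m x}
    (hσ : IsHolomorphicSection m σ) (c : ℂ) : IsHolomorphicSection m (c • σ) := fun φ hφ =>
  (hσ φ hφ).const_smul_section (a := c) |>.congr fun x _ => by
    rw [Pi.smul_apply, Pi.smul_apply, map_smul]

theorem metricKhat_eq_iSup (h : SmoothHermitianMetric n A) (m : ℕ) (x : X)
    (v : Fin n → Tan n x) :
    metricKhat h m x v =
      ⨆ (σ : ∀ x, AdjFiber n A m x) (_ : IsHolomorphicSection m σ)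
        (_ : (sectionDensity h m σ).integral = 1), sectionDensity h m σ x v := by
  have hx := FiberBundle.mem_baseSet_trivializationAt' (F := ℂ) (E := A) x
  have hdensity (σ : ∀ x, AdjFiber n A m x) :
      sectionDensity h m σ x v = h.sq ((trivializationAt ℂ A x).symm x 1) ^ (1 / (m : ℝ)) *
        ‖(trivializationAt ℂ A x ⟨x, evalAdj m v (σ x)⟩).2‖ₑ ^ (2 / (m : ℝ)) := by
    rw [sectionDensity, h.sq_eq_enorm_sq_mul _ hx, ENNReal.mul_rpow_of_nonneg _ _ (by positivity),
      ← ENNReal.rpow_natCast_mul, Nat.cast_ofNat, mul_one_div, mul_comm]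
  simp only [metricKhat, Khat, ENNReal.mul_iSup, hdensity]

theorem sectionDensity_le_integral_mul_metricKhat {h : SmoothHermitianMetric n A} {m : ℕ}
    (hm : m ≠ 0) {σ : ∀ x, AdjFiber n A m x} (hσ : IsHolomorphicSection m σ)
    (h0 : (sectionDensity h m σ).integral ≠ 0) (htop : (sectionDensity h m σ).integral ≠ ⊤)
    (x : X) (v : Fin n → Tan n x) :
    sectionDensity h m σ x v ≤ (sectionDensity h m σ).integral * metricKhat h m x v := by
  set J := (sectionDensity h m σ).integral
  have hJinv : J⁻¹ ≠ ⊤ := ENNReal.inv_ne_top.2 h0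
  obtain ⟨c, hc⟩ : ∃ c : ℂ, ‖c‖ₑ ^ (2 / (m : ℝ)) = J⁻¹ :=
    exists_enorm_rpow_eq (div_ne_zero two_ne_zero (Nat.cast_ne_zero.2 hm))
      (ENNReal.inv_ne_zero.2 htop) hJinv
  have hnormalized : (sectionDensity h m (c • σ)).integral = 1 := by
    rw [sectionDensity_const_smul, hc, Density.integral_const_mul hJinv,
      ENNReal.inv_mul_cancel h0 htop]
  calc sectionDensity h m σ x v = J * sectionDensity h m (c • σ) x v := by
        rw [sectionDensity_const_smul, hc]
        exact (ENNReal.mul_inv_cancel_left h0 htop).symm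
    _ ≤ J * metricKhat h m x v := by
        rw [metricKhat_eq_iSup]
        gcongr
        exact le_iSup₂_of_le (c • σ) (hσ.const_smul c) (le_iSup_of_le hnormalized le_rfl)

theorem metricKhat_le {h h' : SmoothHermitianMetric n A} {C D : ℝ≥0}
    (hC : ∀ x (a : A x), h.sq a ≤ C * h'.sq a) (hD : ∀ x (a : A x), h'.sq a ≤ D * h.sq a)
    {m : ℕ} (hm : m ≠ 0) (x : X) (v : Fin n → Tan n x) :
    metricKhat h m x v ≤ C ^ (1 / (m : ℝ)) * (D ^ (1 / (m : ℝ)) * metricKhat h' m x v) := by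
  rw [metricKhat_eq_iSup h]
  refine iSup₂_le fun σ hσ => iSup_le fun hint => ?_
  have hle : (sectionDensity h' m σ).integral ≤ D ^ (1 / (m : ℝ)) := by
    simpa only [hint, mul_one] using integral_sectionDensity_le hD m σ
  have htop : (sectionDensity h' m σ).integral ≠ ⊤ :=
    ne_top_of_le_ne_top (ENNReal.rpow_ne_top_of_nonneg (by positivity) ENNReal.coe_ne_top) hle
  have h0 : (sectionDensity h' m σ).integral ≠ 0 := fun hzero => by
    have hone := integral_sectionDensity_le hC m σ
    rw [hint, hzero, mul_zero] at hone
    exact one_ne_zero (le_zero_iff.1 hone)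
  calc sectionDensity h m σ x v
      ≤ C ^ (1 / (m : ℝ)) * sectionDensity h' m σ x v := sectionDensity_le hC m σ x v
    _ ≤ C ^ (1 / (m : ℝ)) * ((sectionDensity h' m σ).integral * metricKhat h' m x v) := by
        gcongr
        exact sectionDensity_le_integral_mul_metricKhat hm hσ h0 htop x v
    _ ≤ C ^ (1 / (m : ℝ)) * (D ^ (1 / (m : ℝ)) * metricKhat h' m x v) := by gcongr

theorem KhatInfty_le {h h' : SmoothHermitianMetric n A} (hle : h.IsBoundedBy h')
    (hge : h'.IsBoundedBy h) (x : X) (v : Fin n → Tan n x) :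
    KhatInfty h x v ≤ KhatInfty h' x v := by
  obtain ⟨C, hC⟩ := hle
  obtain ⟨D, hD⟩ := hge
  calc KhatInfty h x v
      ≤ limsup (fun m : ℕ => (C : ℝ≥0∞) ^ (1 / (m : ℝ)) *
          ((D : ℝ≥0∞) ^ (1 / (m : ℝ)) * metricKhat h' m x v)) atTop :=
        limsup_le_limsup <| (eventually_ne_atTop 0).mono fun m hm => metricKhat_le hC hD hm x v
    _ ≤ limsup (fun m : ℕ => (D : ℝ≥0∞) ^ (1 / (m : ℝ)) * metricKhat h' m x v) atTop :=
        limsup_rpow_one_div_mul_le C _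
    _ ≤ KhatInfty h' x v := limsup_rpow_one_div_mul_le D _

end Extremal

theorem hcan_congr {h h' : SmoothHermitianMetric n A} (hK : KhatInfty h = KhatInfty h') :
    hcan h = hcan h' := by
  funext x ξ
  rw [hcan, hcan, hcanWeight, hcanWeight, hK]

end Supercanonical

theorem theorem2p7_general {n : ℕ} {X : Type*} [TopologicalSpace X]
    [ChartedSpace (Supercanonical.Model n) X]
    {A : X → Type*} [TopologicalSpace (TotalSpace ℂ A)] [∀ x, AddCommGroup (A x)]
    [∀ x, Module ℂ (A x)] [∀ x, TopologicalSpace (A x)] [FiberBundle ℂ A] [VectorBundle ℂ ℂ A]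
    {h h' : Supercanonical.SmoothHermitianMetric n A} (hle : h.IsBoundedBy h')
    (hge : h'.IsBoundedBy h) :
    Supercanonical.KhatInfty h = Supercanonical.KhatInfty h' ∧
      Supercanonical.hcan h = Supercanonical.hcan h' := by
  have hK : Supercanonical.KhatInfty h = Supercanonical.KhatInfty h' :=
    funext₂ fun x v => le_antisymm (Supercanonical.KhatInfty_le hle hge x v)
      (Supercanonical.KhatInfty_le hge hle x v)
  exact ⟨hK, Supercanonical.hcan_congr hK⟩

theorem theorem2p7 {n : ℕ} {X : Type*} [TopologicalSpace X] [T2Space X] [CompactSpace X]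
    [ChartedSpace (Supercanonical.Model n) X]
    [IsManifold 𝓘(ℂ, Supercanonical.Model n) ω X]
    (A : X → Type*) [TopologicalSpace (TotalSpace ℂ A)] [∀ x, AddCommGroup (A x)]
    [∀ x, Module ℂ (A x)] [∀ x, TopologicalSpace (A x)] [FiberBundle ℂ A]
    [VectorBundle ℂ ℂ A] [ContMDiffVectorBundle ω ℂ A 𝓘(ℂ, Supercanonical.Model n)]
    (h h' : Supercanonical.SmoothHermitianMetric n A) :
    Supercanonical.KhatInfty h = Supercanonical.KhatInfty h' ∧
      Supercanonical.hcan h = Supercanonical.hcan h' :=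
  theorem2p7_general (h.isBoundedBy h') (h'.isBoundedBy h)
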